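/- Let $d\ge 0$, let $\langle\cdot,\cdot\rangle$ be the standard scalar product of $\mathbb R^d$, and for a set $\mathcal N\subset\mathbb R^d$ and a function $f:\mathbb R^d\to\mathbb R$ put $$P_{\mathcal N}(f)=\{x\in\mathbb R^d:\langle p,x\rangle\le f(p)\ \text{ for all } p\in\mathcal N\}.$$ Let $\mathcal P\subset\mathbb R^d$ be symmetric ($\mathcal P=-\mathcal P$), let $a$ be a quadratic form on $\mathbb R^d$, and let $\mathcal P_s(a)$ be the set of those $p\in\mathcal P$ for which $P_{\mathcal P}(a)\cap\{x:\langle p,x\rangle=a(p)\}$ is a facet of $P_{\mathcal P}(a)$. Suppose that $P(a)=P_{\mathcal P}(a)$ is a Voronoi parallelotope, that is: $P(a)$ is bounded and $d$-dimensional; $a$ is non-negative; every facet of $P(a)$ has the form $P(a)\cap\{x:\langle p,x\rangle=a(p)\}$ with $p\in\mathcal P$; the integral linear combinations of the vectors of $\mathcal P_s(a)$ form a $d$-dimensional lattice $L$; and $\mathcal P\subseteq L$. Suppose moreover that every parity class $v+2L$, $v\in L$, contains a vector at which $a$ attains its minimum on the class, and that $\mathcal P$ contains all such minimal vectors of all parity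 classes, except possibly the vector $0$. Let $e\in\mathbb R^d$ satisfy $\langle e,p\rangle\in\{0,\pm1\}$ for all $p\in\mathcal P_s(a)$; equivalently, $\mathcal P_e:=\{p\in\mathcal P:\langle p,e\rangle\in\{0,\pm1\}\}\supseteq\mathcal P_s(a)$. For $b\ge 0$ let $z(e)=\{\lambda e:-1\le\lambda\le1\}$ and $a_e(p)=b\langle p,e\rangle^2$. Then for every $b\ge 0$ and every set $\mathcal Q$ with $\mathcal P_e\subseteq\mathcal Q\subseteq\mathcal P$ (in particular for $\mathcal Q=\mathcal P$ and for $\mathcal Q=\mathcal P_e$), $$P(a)+b\,z(e)=P(a)+P_{\mathcal Q}(a_e)=P_{\mathcal Q}(a+a_e),$$ where $+$ between sets is Minkowski addition. -/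

import Mathlib

open scoped Pointwise RealInnerProductSpace

/-- The ambient space `ℝᵈ` with its standard scalar product. -/
abbrev RSpace (d : ℕ) : Type := EuclideanSpace ℝ (Fin d)

/-- The polyhedron `P(f) = {x : ⟨p, x⟩ ≤ f(p) for all p ∈ N}` with normal set `N`,
for an arbitrary function `f`. -/
def polyP {d : ℕ} (N : Set (RSpace d)) (f : RSpace d → ℝ) : Set (RSpace d) :=
  {x | ∀ p ∈ N, ⟪p, x⟫ ≤ f p}

/-- The affine hyperplane `H_p(f) = {x : ⟨p, x⟩ = f(p)}`. -/
def hyperplaneH {d : ℕ} (f : RSpace d → ℝ) (p : RSpace d) : Set (RSpace d) :=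
  {x | ⟪p, x⟫ = f p}

/-- `F` is a facet of the `d`-dimensional polytope `P`: a nonempty exposed face of
dimension `d - 1`. -/
def IsFacet {d : ℕ} (P F : Set (RSpace d)) : Prop :=
  IsExposed ℝ P F ∧ F.Nonempty ∧ Module.finrank ℝ (vectorSpan ℝ F) + 1 = d

/-- The set `N_s(a)` of those `p ∈ N` for which `P(a) ∩ H_p(a)` is a facet of `P(a)`. -/
def facetNormals {d : ℕ} (N : Set (RSpace d)) (a : QuadraticForm ℝ (RSpace d)) :
    Set (RSpace d) :=
  {p | p ∈ N ∧ IsFacet (polyP N a) (polyP N a ∩ hyperplaneH a p)}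

/-- The group `L` of integral linear combinations of vectors of `N_s(a)`. -/
def facetLattice {d : ℕ} (N : Set (RSpace d)) (a : QuadraticForm ℝ (RSpace d)) :
    Submodule ℤ (RSpace d) :=
  Submodule.span ℤ (facetNormals N a)

/-- `P(a)`, given by the normal set `N` and the quadratic form `a`, is a Voronoi
parallelotope with lattice `L = facetLattice N a`. -/
structure IsVoronoiParallelotope {d : ℕ} (N : Set (RSpace d))
    (a : QuadraticForm ℝ (RSpace d)) : Prop where
  /-- The normal set is symmetric. -/
  symmetric : ∀ p ∈ N, -p ∈ N
  /-- `P(a)` is bounded. -/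
  bounded : Bornology.IsBounded (polyP N a)
  /-- `P(a)` is `d`-dimensional. -/
  full_dim : (interior (polyP N a)).Nonempty
  /-- The quadratic form `a` is non-negative. -/
  nonneg : ∀ p, 0 ≤ a p
  /-- `N` contains a normal vector of every facet of `P(a)`. -/
  facet_normal : ∀ F, IsFacet (polyP N a) F →
    ∃ p ∈ N, F = polyP N a ∩ hyperplaneH a p
  /-- The group `L` generated by the facet normals is discrete ... -/
  discrete : DiscreteTopology (facetLattice N a)
  /-- ... and of full rank, that is, a `d`-dimensional lattice. -/
  full_rank : Submodule.span ℝ (facetLattice N a : Set (RSpace d)) = ⊤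
  /-- The normal set consists of lattice vectors. -/
  subset_lattice : N ⊆ facetLattice N a

/-- The set `N(a)` of vectors of `L` that are minimal, with respect to `a`, in their parity
class modulo `2L` (the class `2L` itself contributes the vector `0`). -/
def minimalVectors {d : ℕ} (L : Submodule ℤ (RSpace d)) (a : QuadraticForm ℝ (RSpace d)) :
    Set (RSpace d) :=
  {p | p ∈ L ∧ ∀ q ∈ L, a p ≤ a (p + (2 : ℤ) • q)}

/-- `N` contains all nonzero minimal vectors of the parity classes of `L`, each parity class
having a minimal vector. -/
def ContainsContactVectors {d : ℕ} (N : Set (RSpace d)) (L : Submodule ℤ (RSpace d))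
    (a : QuadraticForm ℝ (RSpace d)) : Prop :=
  (∀ v ∈ L, ∃ q ∈ L, v + (2 : ℤ) • q ∈ minimalVectors L a) ∧
    ∀ p ∈ minimalVectors L a, p ≠ 0 → p ∈ N

/-- The dual `S* = {e : ⟨e, p⟩ ∈ {0, ±1} for all p ∈ S}` of a set `S` of vectors. -/
def dualVectors {d : ℕ} (S : Set (RSpace d)) : Set (RSpace d) :=
  {e | ∀ p ∈ S, ⟪e, p⟫ = 0 ∨ ⟪e, p⟫ = 1 ∨ ⟪e, p⟫ = -1}

/-- The set `N_e = {p ∈ N : ⟨p, e⟩ ∈ {0, ±1}}`. -/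
def normalsAt {d : ℕ} (N : Set (RSpace d)) (e : RSpace d) : Set (RSpace d) :=
  {p | p ∈ N ∧ (⟪p, e⟫ = 0 ∨ ⟪p, e⟫ = 1 ∨ ⟪p, e⟫ = -1)}

/-- The segment `z(e) = {t e : -1 ≤ t ≤ 1}`. -/
def segmentZ {d : ℕ} (e : RSpace d) : Set (RSpace d) :=
  {x | ∃ t : ℝ, -1 ≤ t ∧ t ≤ 1 ∧ x = t • e}

/-- The rank one quadratic form `a_e(p) = b ⟨p, e⟩²`. -/
noncomputable def formAE {d : ℕ} (b : ℝ) (e : RSpace d) : RSpace d → ℝ :=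
  fun p => b * ⟪p, e⟫ ^ 2

/-! The three sets form a cycle of inclusions. Since `e` is integral on L, |n| ≤ n² gives b z(e) ⊆
P_M(a_e) (`smul_segmentZ_subset_polyP`), and adding inequalities gives P(a) + P_M(a_e) ⊆ P_M(a +
a_e). The content is P_M(a + a_e) ⊆ P(a) + b z(e) (`polyP_subset_add_segment`).

Let x be in the left side. On normals orthogonal to `e` the form a_e vanishes, so x satisfies the
inequalities of P(a) there. By `inner_le_of_layer` and `exists_add_smul_mem_of_layer` these already
describe the projection of P(a) along `e`, so x + te ∈ P(a) for some t. Clamping t to [-b, b] keeps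
the point in P(a), because ⟨e, p⟩ ∈ {0, ±1} on facet normals and these cut out P(a)
(`polyP_facetNormals_subset`).

The projection statement studies the maximum over l ∈ L of ⟨l, y⟩ - a(l), whose regions of linearity
are translates of P(a), along the line y = x + te. At its minimum, crossing facets one layer at a
time leads to a maximiser orthogonal to `e`, so the minimum is at most 0. -/

/-! ### Non-negative and positive definite quadratic forms. -/

section QuadraticForms

variable {d : ℕ} (a : QuadraticForm ℝ (RSpace d))

lemma quadraticForm_continuous : Continuous a := by
  have h : ∀ x, a x = (1 / 2 : ℝ) * (a.polarBilin).toContinuousBilinearMap x x := by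
    intro x
    rw [LinearMap.toContinuousBilinearMap_apply, QuadraticMap.polarBilin_apply_apply,
      QuadraticMap.polar_self]
    simp
  have h' : (a : RSpace d → ℝ) =
      fun x => (1 / 2 : ℝ) * (a.polarBilin).toContinuousBilinearMap x x := funext h
  rw [h']
  fun_prop

lemma quadraticForm_parallelogram (x y : RSpace d) :
    a (x + y) + a (x - y) = 2 * a x + 2 * a y := by
  rw [sub_eq_add_neg, QuadraticMap.map_add a x y, QuadraticMap.map_add a x (-y),
    QuadraticMap.map_neg, QuadraticMap.polar_neg_right]
  ring

lemma quadraticForm_add_smul (x y : RSpace d) (t : ℝ) :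
    a (x + t • y) = a x + t * QuadraticMap.polar a x y + t ^ 2 * a y := by
  rw [QuadraticMap.map_add a x, QuadraticMap.map_smul, QuadraticMap.polar_smul_right,
    smul_eq_mul, smul_eq_mul]
  ring

/-- A vector in the null cone of a non-negative form lies in its radical. -/
lemma polar_eq_zero_of_nonneg (ha : ∀ p, 0 ≤ a p) {v : RSpace d} (hv : a v = 0)
    (w : RSpace d) : QuadraticMap.polar a w v = 0 := by
  by_contra hne
  have h := ha (w + (-(a w + 1) / QuadraticMap.polar a w v) • v)
  rw [quadraticForm_add_smul, hv, div_mul_cancel₀ _ hne] at h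
  linarith

/-- The Riesz representative of the linear form `m ↦ a(l + m) - a(l) - a(m)`. -/
lemma exists_inner_eq_polar (l : RSpace d) :
    ∃ c : RSpace d, ∀ m, ⟪m, c⟫ = QuadraticMap.polar a l m := by
  refine ⟨(InnerProductSpace.toDual ℝ (RSpace d)).symm
    (LinearMap.toContinuousLinearMap (a.polarBilin l)), fun m => ?_⟩
  rw [real_inner_comm, InnerProductSpace.toDual_symm_apply]
  rfl

lemma exists_pos_mul_sq_le (ha : ∀ v, v ≠ 0 → 0 < a v) :
    ∃ δ > 0, ∀ v, δ * ‖v‖ ^ 2 ≤ a v := by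
  have hcomp : IsCompact (Metric.sphere (0 : RSpace d) 1) := isCompact_sphere _ _
  rcases (Metric.sphere (0 : RSpace d) 1).eq_empty_or_nonempty with hemp | hne
  · refine ⟨1, one_pos, fun v => ?_⟩
    have hv : v = 0 := by
      by_contra hv
      have : (‖v‖⁻¹) • v ∈ Metric.sphere (0 : RSpace d) 1 := by
        simp [norm_smul, hv]
      simp [hemp] at this
    simp [hv]
  · obtain ⟨u, hu, hmin⟩ := hcomp.exists_isMinOn hne (quadraticForm_continuous a).continuousOn
    have hu0 : u ≠ 0 := by
      rintro rfl
      simp at hu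
    refine ⟨a u, ha u hu0, fun v => ?_⟩
    by_cases hv : v = 0
    · simp [hv]
    have hmem : (‖v‖⁻¹) • v ∈ Metric.sphere (0 : RSpace d) 1 := by
      simp [norm_smul, hv]
    have h := hmin hmem
    simp only [Set.mem_ofPred_eq] at h
    have hn : ‖v‖ ≠ 0 := norm_ne_zero_iff.2 hv
    have hav : a v = ‖v‖ ^ 2 * a (‖v‖⁻¹ • v) := by
      rw [QuadraticMap.map_smul, smul_eq_mul]
      field_simp
    rw [hav, mul_comm]
    gcongr

end QuadraticForms

/-! ### Discreteness, covering radius and finiteness for lattices. -/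

section Lattices

variable {d : ℕ} {L : Submodule ℤ (RSpace d)}

lemma exists_pos_le_norm (hL : DiscreteTopology L) :
    ∃ r > 0, ∀ l ∈ L, l ≠ 0 → r ≤ ‖l‖ := by
  obtain ⟨r, hr, h⟩ := Metric.isOpen_singleton_iff.1 (isOpen_discrete ({0} : Set L))
  refine ⟨r, hr, fun l hl h0 => ?_⟩
  by_contra hlt
  have := h ⟨l, hl⟩ (by rw [Subtype.dist_eq]; simpa using hlt)
  exact h0 (congrArg Subtype.val this)

lemma finite_inter_of_isBounded (hL : DiscreteTopology L) {K : Set (RSpace d)}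
    (hK : Bornology.IsBounded K) : (K ∩ L).Finite := by
  refine Metric.finite_isBounded_inter_isClosed DiscreteTopology.isDiscrete hK ?_
  rw [← Submodule.coe_toAddSubgroup]
  have : DiscreteTopology L.toAddSubgroup := hL
  exact AddSubgroup.isClosed_of_discrete

lemma exists_norm_sub_le (hL : Submodule.span ℝ (L : Set (RSpace d)) = ⊤) :
    ∃ C : ℝ, ∀ v, ∃ l ∈ L, ‖v - l‖ ≤ C := by
  let b := Module.Basis.ofSpan hL.ge
  have : Finite ((linearIndepOn_empty ℝ id).extend (Set.empty_subset (L : Set (RSpace d)))) :=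
    Module.Finite.finite_basis b
  have := Fintype.ofFinite
    ((linearIndepOn_empty ℝ id).extend (Set.empty_subset (L : Set (RSpace d))))
  refine ⟨∑ i, ‖b i‖, fun v => ⟨ZSpan.floor b v, ?_, ZSpan.norm_fract_le b v⟩⟩
  exact Submodule.span_le.2 (Module.Basis.ofSpan_subset hL.ge) (ZSpan.floor b v).2

/-- A non-negative form bounded away from zero on the nonzero vectors of a full lattice is
positive definite. -/
lemma pos_of_pos_on_lattice (a : QuadraticForm ℝ (RSpace d)) (ha : ∀ p, 0 ≤ a p)
    (hL : Submodule.span ℝ (L : Set (RSpace d)) = ⊤) {δ : ℝ} (hδ : 0 < δ)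
    (hδL : ∀ l ∈ L, l ≠ 0 → δ ≤ a l) {v : RSpace d} (hv : v ≠ 0) : 0 < a v := by
  refine lt_of_le_of_ne (ha v) fun h0 => ?_
  -- If a(v) = 0, then v lies in the radical. Approximate the multiples nv by lattice points with
  -- bounded remainders; two remainders of a convergent subsequence differ by a small w. The
  -- difference of the lattice points is -w modulo v, so its `a`-value is a(w) < δ and it vanishes.
  -- Then w is a nonzero integral multiple of v, too long.
  obtain ⟨C, hC⟩ := exists_norm_sub_le hL
  choose l hl hlC using fun n : ℕ => hC ((n : ℝ) • v)
  obtain ⟨y, -, φ, hφ, hy⟩ := tendsto_subseq_of_bounded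
    (Metric.isBounded_closedBall (x := (0 : RSpace d)) (r := C))
    (x := fun n : ℕ => (n : ℝ) • v - l n) (fun n => by simpa using hlC n)
  have hsmall : ∀ᶠ w in nhds (0 : RSpace d), a w < δ ∧ ‖w‖ < ‖v‖ := by
    have h1 : ∀ᶠ w in nhds (0 : RSpace d), a w < δ :=
      (quadraticForm_continuous a).continuousAt.eventually_lt continuousAt_const (by simpa)
    have h2 : ∀ᶠ w in nhds (0 : RSpace d), ‖w‖ < ‖v‖ :=
      continuous_norm.continuousAt.eventually_lt continuousAt_const (by simpa)
    exact h1.and h2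
  have hshift := (hy.comp (Filter.tendsto_add_atTop_nat 1)).sub hy
  rw [sub_self] at hshift
  obtain ⟨n, hn1, hn2⟩ := (hshift.eventually hsmall).exists
  simp only [Function.comp_apply] at hn1 hn2
  set j := φ n
  set k := φ (n + 1)
  have hjk : j < k := hφ (Nat.lt_succ_self n)
  have hw : l k - l j + (((k : ℝ) • v - l k) - ((j : ℝ) • v - l j)) = ((k : ℝ) - j) • v := by
    rw [sub_smul]; abel
  set w := ((k : ℝ) • v - l k) - ((j : ℝ) • v - l j)
  have hlw : l k - l j = -w + ((k : ℝ) - j) • v := by rw [← hw]; abel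
  have hal : a (l k - l j) < δ := by
    rw [hlw, quadraticForm_add_smul, polar_eq_zero_of_nonneg a ha h0.symm, ← h0,
      QuadraticMap.map_neg]
    linarith
  have hl0 : l k - l j = 0 := by
    by_contra hne
    exact absurd (hδL _ (L.sub_mem (hl k) (hl j)) hne) (not_le.2 hal)
  have hkj : (1 : ℝ) ≤ k - j := by
    have : (j : ℝ) + 1 ≤ k := by exact_mod_cast hjk
    linarith
  rw [hl0, zero_add] at hw
  rw [hw, norm_smul, Real.norm_of_nonneg (by linarith)] at hn2
  nlinarith [norm_nonneg v]

lemma finite_le_inner_sub (hL : DiscreteTopology L) (a : QuadraticForm ℝ (RSpace d))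
    {δ : ℝ} (hδ : 0 < δ) (ha : ∀ v, δ * ‖v‖ ^ 2 ≤ a v) (y : RSpace d) (c : ℝ) :
    {l | l ∈ L ∧ c ≤ ⟪l, y⟫ - a l}.Finite := by
  refine (finite_inter_of_isBounded hL (Metric.isBounded_closedBall (x := (0 : RSpace d))
    (r := (‖y‖ + |c| + δ) / δ))).subset fun l hl => ⟨?_, hl.1⟩
  have h1 := real_inner_le_norm l y
  have h2 := ha l
  have h3 := hl.2
  rw [mem_closedBall_zero_iff, le_div_iff₀ hδ]
  by_contra! hlt
  have h4 := neg_abs_le c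
  have h5 : 1 ≤ ‖l‖ := by
    by_contra! h
    nlinarith [norm_nonneg y, abs_nonneg c]
  nlinarith [norm_nonneg y, abs_nonneg c]

end Lattices

/-! ### Positivity on L, and descriptions of P(a) by lattice vectors and by facets. -/

section Voronoi

variable {d : ℕ} {N : Set (RSpace d)} {a : QuadraticForm ℝ (RSpace d)}

/-- P(a) contains a ball around some y. Testing p at y + u and -p at y - u, with u parallel to p,
and averaging eliminates y. -/
lemma exists_pos_mul_norm_le (hP : IsVoronoiParallelotope N a) :
    ∃ ρ > 0, ∀ p ∈ N, ρ * ‖p‖ ≤ a p := by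
  obtain ⟨y, hy⟩ := hP.full_dim
  obtain ⟨ε, hε, hball⟩ := Metric.isOpen_iff.1 isOpen_interior y hy
  refine ⟨ε / 2, half_pos hε, fun p hp => ?_⟩
  by_cases h0 : p = 0
  · simp [h0]
  have hn : ‖p‖ ≠ 0 := norm_ne_zero_iff.2 h0
  set u := (ε / 2 / ‖p‖) • p with hu
  have hnu : ‖u‖ = ε / 2 := by
    rw [hu, norm_smul, Real.norm_of_nonneg (by positivity)]
    field_simp
  have h1 := interior_subset (hball (show y + u ∈ Metric.ball y ε by simp [hnu, hε])) p hp
  have h2 := interior_subset (hball (show y - u ∈ Metric.ball y ε by simp [hnu, hε]))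
    (-p) (hP.symmetric p hp)
  rw [QuadraticMap.map_neg, inner_neg_left, inner_sub_right] at h2
  rw [inner_add_right] at h1
  have h3 : ⟪p, u⟫ = ε / 2 * ‖p‖ := by
    rw [hu, real_inner_smul_right, real_inner_self_eq_norm_sq]
    field_simp
  linarith

/-- Descent by halving: either the minimal vector of the parity class is nonzero, hence in `N` and
bounded below, or it is 0 and l is twice a shorter lattice vector. The induction is on the dyadic
size of l. -/
lemma exists_pos_le_on_lattice (hP : IsVoronoiParallelotope N a)
    (hC : ContainsContactVectors N (facetLattice N a) a) :
    ∃ δ > 0, ∀ l ∈ facetLattice N a, l ≠ 0 → δ ≤ a l := by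
  obtain ⟨ρ, hρ, hρN⟩ := exists_pos_mul_norm_le hP
  obtain ⟨r, hr, hrL⟩ := exists_pos_le_norm hP.discrete
  have key : ∀ n : ℕ, ∀ l ∈ facetLattice N a, l ≠ 0 → ‖l‖ < 2 ^ n * r → ρ * r ≤ a l := by
    intro n
    induction n with
    | zero =>
      intro l hl h0 hlt
      have := hrL l hl h0
      simp only [pow_zero, one_mul] at hlt
      linarith
    | succ n ih =>
      intro l hl h0 hlt
      obtain ⟨q, hq, hm⟩ := hC.1 l hl
      by_cases hz : l + (2 : ℤ) • q = 0
      · have hlq : l = (2 : ℝ) • (-q) := by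
          rw [two_zsmul] at hz
          rw [two_smul, eq_neg_of_add_eq_zero_left hz, neg_add]
        have hq0 : -q ≠ 0 := by
          rintro h
          exact h0 (by rw [hlq, h, smul_zero])
        have h1 := ih (-q) (neg_mem hq) hq0 (by
          rw [hlq, norm_smul, pow_succ] at hlt
          norm_num at hlt ⊢
          linarith)
        rw [hlq, QuadraticMap.map_smul, smul_eq_mul]
        linarith [hP.nonneg (-q)]
      · have h1 := hm.2 (-q) (neg_mem hq)
        rw [smul_neg, add_neg_cancel_right] at h1
        refine le_trans ?_ ((hρN _ (hC.2 _ hm hz)).trans h1)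
        gcongr
        exact hrL _ hm.1 hz
  refine ⟨ρ * r, by positivity, fun l hl h0 => ?_⟩
  obtain ⟨n, hn⟩ := pow_unbounded_of_one_lt (‖l‖ / r) (one_lt_two : (1 : ℝ) < 2)
  exact key n l hl h0 ((div_lt_iff₀ hr).1 hn)

/-- Only finitely many lattice vectors `l` satisfy `c ≤ ⟨l, y⟩ - a(l)`. -/
lemma finite_lattice_le_inner_sub (hP : IsVoronoiParallelotope N a)
    (hC : ContainsContactVectors N (facetLattice N a) a) (y : RSpace d) (c : ℝ) :
    {l | l ∈ facetLattice N a ∧ c ≤ ⟪l, y⟫ - a l}.Finite := by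
  obtain ⟨δ, hδ, hδL⟩ := exists_pos_le_on_lattice hP hC
  obtain ⟨η, hη, hηa⟩ := exists_pos_mul_sq_le a fun v hv =>
    pos_of_pos_on_lattice a hP.nonneg hP.full_rank hδ hδL hv
  exact finite_le_inner_sub hP.discrete a hη hηa y c

/-- A lattice vector which is not minimal in its parity class is a sum `u + v` of lattice
vectors with `a(u) + a(v) < a(u + v)`. -/
lemma exists_add_eq_of_notMem_minimalVectors
    (hC : ContainsContactVectors N (facetLattice N a) a)
    {l : RSpace d} (hl : l ∈ facetLattice N a) (hmin : l ∉ minimalVectors (facetLattice N a) a) :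
    ∃ u ∈ facetLattice N a, ∃ v ∈ facetLattice N a, u + v = l ∧ a u + a v < a l := by
  obtain ⟨q, hq, hm⟩ := hC.1 l hl
  have hlt : a (l + (2 : ℤ) • q) < a l := by
    by_contra! hle
    refine hmin ⟨hl, fun s hs => hle.trans ?_⟩
    have h := hm.2 (s - q) (sub_mem hs hq)
    rwa [add_assoc, ← smul_add, add_sub_cancel] at h
  -- With u = l + q and v = -q one has u - v = l + 2q, so the parallelogram law gives 2(a(u) + a(v))
  -- = a(l) + a(l + 2q) < 2a(l).
  refine ⟨l + q, add_mem hl hq, -q, neg_mem hq, by abel, ?_⟩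
  have hpar := quadraticForm_parallelogram a (l + q) (-q)
  rw [add_neg_cancel_right, sub_neg_eq_add, add_assoc, ← two_zsmul] at hpar
  linarith

lemma facetNormals_subset_lattice : facetNormals N a ⊆ facetLattice N a :=
  Submodule.subset_span

/-- A violated lattice inequality with least a(l) is not minimal in its class; splitting l = u + v
would violate one with smaller `a`-value. -/
lemma polyP_subset_polyP_lattice (hP : IsVoronoiParallelotope N a)
    (hC : ContainsContactVectors N (facetLattice N a) a) :
    polyP N a ⊆ polyP (facetLattice N a) a := by
  intro y hy
  by_contra hcon
  have hne : {l | l ∈ facetLattice N a ∧ a l < ⟪l, y⟫}.Nonempty := by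
    simpa [polyP, Set.Nonempty] using hcon
  have hfin : {l | l ∈ facetLattice N a ∧ a l < ⟪l, y⟫}.Finite :=
    (finite_lattice_le_inner_sub hP hC y 0).subset fun l hl => ⟨hl.1, by linarith [hl.2]⟩
  obtain ⟨l, ⟨hlL, hly⟩, hlmin⟩ := Set.exists_min_image _ a hfin hne
  have hl0 : l ≠ 0 := by
    rintro rfl
    simp at hly
  have hnm : l ∉ minimalVectors (facetLattice N a) a := fun hm =>
    absurd (hy l (hC.2 l hm hl0)) (not_le.2 hly)
  obtain ⟨u, hu, v, hv, rfl, hlt⟩ := exists_add_eq_of_notMem_minimalVectors hC hlL hnm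
  rw [inner_add_left] at hly
  rcases lt_or_ge (a u) ⟪u, y⟫ with h | h
  · have := hlmin u ⟨hu, h⟩
    linarith [hP.nonneg v]
  · have := hlmin v ⟨hv, by linarith⟩
    linarith [hP.nonneg u]

/-- A contact vector of `P(a)`, that is, a nonzero lattice vector whose inequality is tight at
a point of `P(a)`, belongs to `N`. -/
lemma mem_of_inner_eq
    (hC : ContainsContactVectors N (facetLattice N a) a) {z l : RSpace d}
    (hz : z ∈ polyP (facetLattice N a) a) (hl : l ∈ facetLattice N a) (hl0 : l ≠ 0)
    (hlz : ⟪l, z⟫ = a l) : l ∈ N := by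
  by_contra hN
  obtain ⟨u, hu, v, hv, rfl, hlt⟩ :=
    exists_add_eq_of_notMem_minimalVectors hC hl fun hm => hN (hC.2 l hm hl0)
  rw [inner_add_left] at hlz
  linarith [hz u hu, hz v hv]

/-- A face of `P(a)` cut out by a vector of `N` and not a facet spans, together with any further
point, a proper affine subspace. -/
lemma affineSpan_insert_ne_top {p y : RSpace d} (hp : p ∈ N) (hp0 : p ≠ 0)
    (hpf : p ∉ facetNormals N a) (hne : (polyP N a ∩ hyperplaneH a p).Nonempty) :
    affineSpan ℝ (insert y (polyP N a ∩ hyperplaneH a p)) ≠ ⊤ := by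
  set F := polyP N a ∩ hyperplaneH a p with hF
  have hexp : IsExposed ℝ (polyP N a) F := by
    refine fun _ => ⟨innerSL ℝ p, ?_⟩
    obtain ⟨w, hw, hwp⟩ := hne
    ext x
    simp only [innerSL_apply_apply, Set.mem_ofPred_eq]
    constructor
    · rintro ⟨hx, hxp⟩
      exact ⟨hx, fun z hz => (hz p hp).trans hxp.ge⟩
    · rintro ⟨hx, hxm⟩
      exact ⟨hx, le_antisymm (hx p hp) (hwp.ge.trans (hxm w hw))⟩
  have hdim : Module.finrank ℝ (vectorSpan ℝ F) + 1 ≠ d := fun h => hpf ⟨hp, hexp, hne, h⟩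
  have hsub : vectorSpan ℝ F ≤ (ℝ ∙ p)ᗮ := by
    rw [vectorSpan_def, Submodule.span_le]
    rintro _ ⟨x, hx, z, hz, rfl⟩
    rw [SetLike.mem_coe, Submodule.mem_orthogonal_singleton_iff_inner_right]
    change ⟪p, x - z⟫ = 0
    rw [inner_sub_right, show ⟪p, x⟫ = a p from hx.2, show ⟪p, z⟫ = a p from hz.2, sub_self]
  have hle : Module.finrank ℝ (vectorSpan ℝ F) + 1 ≤ d := by
    have h1 := Submodule.finrank_mono hsub
    have h2 := Submodule.finrank_add_finrank_orthogonal (ℝ ∙ p)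
    rw [finrank_span_singleton hp0, finrank_euclideanSpace_fin] at h2
    omega
  -- The face has dimension at most d - 2, so one more point spans dimension at most d - 1.
  intro htop
  have h1 := finrank_vectorSpan_insert_le_set ℝ F y
  rw [← direction_affineSpan, htop, AffineSubspace.direction_top, finrank_top,
    finrank_euclideanSpace_fin] at h1
  omega

/-- A Voronoi parallelotope is the intersection of its facet half-spaces. -/
lemma polyP_facetNormals_subset (hP : IsVoronoiParallelotope N a)
    (hC : ContainsContactVectors N (facetLattice N a) a) :
    polyP (facetNormals N a) a ⊆ polyP N a := by
  intro y hy
  by_contra hcon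
  set S := {p | p ∈ N ∧ a p < ⟪p, y⟫} with hS
  have hSfin : S.Finite := (finite_lattice_le_inner_sub hP hC y 0).subset fun l hl =>
    ⟨hP.subset_lattice hl.1, by linarith [hl.2]⟩
  have hSne : S.Nonempty := by
    simpa [polyP, Set.Nonempty, hS] using hcon
  set T := {p | p ∈ S ∧ (polyP N a ∩ hyperplaneH a p).Nonempty} with hT
  have hTfin : T.Finite := hSfin.subset fun p hp => hp.1
  -- Segments from interior points to y leave P(a) through faces whose inequality y violates, hence
  -- not facets. The interior would thus be covered by finitely many proper affine subspaces, a null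
  -- set.
  have hcover : interior (polyP N a) ⊆ ⋃ p ∈ T,
      (affineSpan ℝ (insert y (polyP N a ∩ hyperplaneH a p)) : Set (RSpace d)) := by
    intro w hw
    have hwP : w ∈ polyP N a := interior_subset hw
    -- the point where the segment from `w` to `y` leaves the polytope
    have hpos : ∀ p ∈ S, 0 < ⟪p, y⟫ - ⟪p, w⟫ := fun p hp => by
      linarith [hp.2, hwP p hp.1]
    obtain ⟨p, hp, hpmin⟩ := Set.exists_min_image S
      (fun p => (a p - ⟪p, w⟫) / (⟪p, y⟫ - ⟪p, w⟫)) hSfin hSne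
    set t := (a p - ⟪p, w⟫) / (⟪p, y⟫ - ⟪p, w⟫) with ht
    have ht0 : 0 ≤ t := div_nonneg (by linarith [hwP p hp.1]) (hpos p hp).le
    have ht1 : t < 1 := (div_lt_one (hpos p hp)).2 (by linarith [hp.2])
    have hin : ∀ q, ⟪q, AffineMap.lineMap w y t⟫ = ⟪q, w⟫ + t * (⟪q, y⟫ - ⟪q, w⟫) := by
      intro q
      rw [AffineMap.lineMap_apply_module', inner_add_right, real_inner_smul_right,
        inner_sub_right]
      ring
    have huF : AffineMap.lineMap w y t ∈ polyP N a ∩ hyperplaneH a p := by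
      constructor
      · intro q hq
        rw [hin]
        by_cases hqS : q ∈ S
        · have := (le_div_iff₀ (hpos q hqS)).1 (hpmin q hqS)
          linarith
        · have h1 : ⟪q, y⟫ ≤ a q := by
            by_contra! h
            exact hqS ⟨hq, h⟩
          nlinarith [hwP q hq]
      · show ⟪p, _⟫ = a p
        rw [hin, ht, div_mul_cancel₀ _ (hpos p hp).ne']
        ring
    refine Set.mem_biUnion (show p ∈ T from ⟨hp, _, huF⟩) ?_
    have hyA : y ∈ affineSpan ℝ (insert y (polyP N a ∩ hyperplaneH a p)) :=
      mem_affineSpan ℝ (Set.mem_insert _ _)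
    have huA : AffineMap.lineMap w y t ∈
        affineSpan ℝ (insert y (polyP N a ∩ hyperplaneH a p)) :=
      mem_affineSpan ℝ (Set.mem_insert_of_mem _ huF)
    have hw_eq : w = AffineMap.lineMap y (AffineMap.lineMap w y t) (1 / (1 - t)) := by
      have h1 : (1 - t) ≠ 0 := by linarith
      have h2 : AffineMap.lineMap w y t - y = (1 - t) • (w - y) := by
        rw [AffineMap.lineMap_apply_module]
        module
      rw [AffineMap.lineMap_apply_module' y, h2, smul_smul, one_div, inv_mul_cancel₀ h1, one_smul,
        sub_add_cancel]
    rw [hw_eq]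
    exact AffineMap.lineMap_mem _ hyA huA
  have hnull : MeasureTheory.volume (interior (polyP N a)) = 0 := by
    refine MeasureTheory.measure_mono_null hcover
      ((MeasureTheory.measure_biUnion_null_iff hTfin.countable).2 fun p hp => ?_)
    refine MeasureTheory.Measure.addHaar_affineSubspace _ _
      (affineSpan_insert_ne_top hp.1.1 ?_ ?_ hp.2)
    · rintro rfl
      simpa using hp.1.2
    · exact fun hf => absurd (hy p hf) (not_le.2 hp.1.2)
  exact (isOpen_interior.measure_pos _ hP.full_dim).ne' hnull

end Voronoi

/-! ### Projection of P(a) along e, and the Minkowski sum. -/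

section Projection

variable {d : ℕ} {N : Set (RSpace d)} {a : QuadraticForm ℝ (RSpace d)} {e : RSpace d}

lemma neg_mem_dualVectors {S : Set (RSpace d)} (he : e ∈ dualVectors S) :
    -e ∈ dualVectors S := by
  intro p hp
  rcases he p hp with h | h | h <;> simp [inner_neg_left, h]

lemma exists_int_inner_eq (he : e ∈ dualVectors (facetNormals N a)) {l : RSpace d}
    (hl : l ∈ facetLattice N a) : ∃ n : ℤ, ⟪l, e⟫ = n := by
  induction hl using Submodule.span_induction with
  | mem p hp =>
    rw [real_inner_comm]
    rcases he p hp with h | h | h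
    · exact ⟨0, by simp [h]⟩
    · exact ⟨1, by simp [h]⟩
    · exact ⟨-1, by simp [h]⟩
  | zero => exact ⟨0, by simp⟩
  | add x y _ _ hx hy =>
    obtain ⟨m, hm⟩ := hx
    obtain ⟨n, hn⟩ := hy
    exact ⟨m + n, by rw [inner_add_left, hm, hn]; push_cast; rfl⟩
  | smul k x _ hx =>
    obtain ⟨m, hm⟩ := hx
    exact ⟨k * m, by
      rw [← Int.cast_smul_eq_zsmul ℝ, real_inner_smul_left, hm]; push_cast; rfl⟩

/-- A point of `P(a)` either lies on a facet through which the direction `e` leaves `P(a)`, or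
can be moved in the direction `e`. -/
lemma exists_facetNormal_or_exists_add_smul_mem (hP : IsVoronoiParallelotope N a)
    (hC : ContainsContactVectors N (facetLattice N a) a)
    (he : e ∈ dualVectors (facetNormals N a)) {w : RSpace d} (hw : w ∈ polyP N a) :
    (∃ p ∈ facetNormals N a, ⟪p, e⟫ = 1 ∧ ⟪p, w⟫ = a p) ∨
      ∃ ε > (0 : ℝ), w + ε • e ∈ polyP N a := by
  refine or_iff_not_imp_left.2 fun hno => ?_
  push Not at hno
  -- Only normals with ⟨p, e⟩ = 1 limit the motion; those with slack at least 1 allow any ε ≤ 1,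
  -- leaving finitely many.
  set S := {p | p ∈ facetNormals N a ∧ ⟪p, e⟫ = 1 ∧ a p < ⟪p, w⟫ + 1} with hS
  have hSfin : S.Finite := (finite_lattice_le_inner_sub hP hC w (-1)).subset fun p hp =>
    ⟨facetNormals_subset_lattice hp.1, by linarith [hp.2.2]⟩
  have hε : ∃ ε > 0, ε ≤ (1 : ℝ) ∧ ∀ p ∈ S, ε ≤ a p - ⟪p, w⟫ := by
    rcases S.eq_empty_or_nonempty with h | h
    · exact ⟨1, one_pos, le_rfl, by simp [h]⟩
    · obtain ⟨p, hp, hpmin⟩ := Set.exists_min_image S (fun p => a p - ⟪p, w⟫) hSfin h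
      refine ⟨a p - ⟪p, w⟫, ?_, by linarith [hp.2.2], hpmin⟩
      exact sub_pos.2 (lt_of_le_of_ne (hw p hp.1.1) (hno p hp.1 hp.2.1))
  obtain ⟨ε, hε0, hε1, hεS⟩ := hε
  refine ⟨ε, hε0, polyP_facetNormals_subset hP hC fun p hp => ?_⟩
  rw [inner_add_right, real_inner_smul_right]
  have hwp := hw p hp.1
  rcases he p hp with h | h | h <;> rw [real_inner_comm] at h <;> rw [h]
  · linarith
  · by_cases hpS : p ∈ S
    · linarith [hεS p hpS]
    · have : ⟪p, w⟫ + 1 ≤ a p := by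
        by_contra! hlt
        exact hpS ⟨hp, h, hlt⟩
      linarith
  · linarith

/-- If `l` maximises `⟨l, z⟩ - a(l)` over the lattice, then either some lattice neighbour one
layer further in the direction `e` does so as well, or `l` remains maximal for some point
`z + εe`. -/
lemma exists_neighbour_or_maximal (hP : IsVoronoiParallelotope N a)
    (hC : ContainsContactVectors N (facetLattice N a) a)
    (he : e ∈ dualVectors (facetNormals N a)) {z l : RSpace d} (hl : l ∈ facetLattice N a)
    (hmax : ∀ m ∈ facetLattice N a, ⟪m, z⟫ - a m ≤ ⟪l, z⟫ - a l) :
    (∃ p ∈ facetLattice N a, ⟪p, e⟫ = 1 ∧ ⟪l + p, z⟫ - a (l + p) = ⟪l, z⟫ - a l) ∨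
      ∃ ε > 0, ∀ m ∈ facetLattice N a,
        ⟪m, z + ε • e⟫ - a m ≤ ⟪l, z⟫ - a l + ε * ⟪l, e⟫ := by
  -- Passing from l to l + m changes the value by ⟨m, z - c⟩ - a(m), so maximality of l puts z - c
  -- in P(a).
  obtain ⟨c, hc⟩ := exists_inner_eq_polar a l
  have hw : z - c ∈ polyP N a := by
    intro m hm
    have h := hmax (l + m) (add_mem hl (hP.subset_lattice hm))
    rw [QuadraticMap.map_add a l m, inner_add_left] at h
    rw [inner_sub_right, hc]
    linarith
  rcases exists_facetNormal_or_exists_add_smul_mem hP hC he hw with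
    ⟨p, hp, hpe, hpw⟩ | ⟨ε, hε, hmem⟩
  · refine Or.inl ⟨p, facetNormals_subset_lattice hp, hpe, ?_⟩
    rw [inner_sub_right, hc] at hpw
    rw [QuadraticMap.map_add a l p, inner_add_left]
    linarith
  · refine Or.inr ⟨ε, hε, fun m hm => ?_⟩
    have h := polyP_subset_polyP_lattice hP hC hmem (m - l) (sub_mem hm hl)
    have ha : a m = a l + a (m - l) + QuadraticMap.polar a l (m - l) := by
      rw [← QuadraticMap.map_add, add_sub_cancel]
    rw [inner_add_right, inner_sub_right, hc, real_inner_smul_right, inner_sub_left,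
      inner_sub_left] at h
    rw [inner_add_right, real_inner_smul_right, ha]
    linarith

/-- The function `t ↦ sup {⟨l, x + te⟩ - a(l) : l ∈ L}` attains its minimum, and the supremum is
attained at the minimising point. -/
lemma exists_minimal_level (hP : IsVoronoiParallelotope N a)
    (hC : ContainsContactVectors N (facetLattice N a) a) (x : RSpace d)
    {l₀ : RSpace d} (hl₀ : l₀ ∈ facetLattice N a) (hl₀e : ⟪l₀, e⟫ ≠ 0) :
    ∃ t c : ℝ, (∀ l ∈ facetLattice N a, ⟪l, x + t • e⟫ - a l ≤ c) ∧
      (∀ t' c' : ℝ, (∀ l ∈ facetLattice N a, ⟪l, x + t' • e⟫ - a l ≤ c') → c ≤ c') ∧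
      ∃ l ∈ facetLattice N a, ⟪l, x + t • e⟫ - a l = c := by
  have hbdd : ∀ y : RSpace d, ∃ c, ∀ l ∈ facetLattice N a, ⟪l, y⟫ - a l ≤ c := by
    intro y
    obtain ⟨c, hc⟩ := ((finite_lattice_le_inner_sub hP hC y 0).image
      (fun l => ⟪l, y⟫ - a l)).bddAbove
    refine ⟨max c 0, fun l hl => ?_⟩
    rcases le_total 0 (⟪l, y⟫ - a l) with h | h
    · exact (hc ⟨l, ⟨hl, h⟩, rfl⟩).trans (le_max_left _ _)
    · exact h.trans (le_max_right _ _)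
  have hnn : ∀ y c, (∀ l ∈ facetLattice N a, ⟪l, y⟫ - a l ≤ c) → 0 ≤ c := by
    intro y c h
    simpa using h 0 (zero_mem _)
  obtain ⟨c₁, hc₁⟩ := hbdd x
  set K := {s : ℝ × ℝ | (∀ l ∈ facetLattice N a, ⟪l, x + s.1 • e⟫ - a l ≤ s.2) ∧ s.2 ≤ c₁}
    with hK
  have hclosed : IsClosed K := by
    have : K = (⋂ l ∈ facetLattice N a, {s : ℝ × ℝ | ⟪l, x + s.1 • e⟫ - a l ≤ s.2}) ∩
        {s | s.2 ≤ c₁} := by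
      ext s
      simp [hK]
    rw [this]
    refine (isClosed_biInter fun l _ => isClosed_le (by fun_prop) (by fun_prop)).inter
      (isClosed_le (by fun_prop) (by fun_prop))
  -- The inequalities of l₀ and -l₀ bound |t|, which makes the truncated epigraph `K` compact.
  set T := (c₁ + a l₀ + |⟪l₀, x⟫|) / |⟪l₀, e⟫| with hT
  have hsub : K ⊆ Set.Icc (-T) T ×ˢ Set.Icc 0 c₁ := by
    rintro ⟨t, c⟩ ⟨h1, h2⟩
    simp only at h1 h2
    refine ⟨abs_le.1 ?_, hnn _ _ h1, h2⟩
    have h3 := h1 l₀ hl₀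
    have h4 := h1 (-l₀) (neg_mem hl₀)
    rw [inner_add_right, real_inner_smul_right] at h3 h4
    rw [QuadraticMap.map_neg, inner_neg_left, inner_neg_left] at h4
    rw [hT, le_div_iff₀ (abs_pos.2 hl₀e), ← abs_mul]
    have h5 := neg_abs_le ⟪l₀, x⟫
    have h6 := le_abs_self ⟪l₀, x⟫
    exact abs_le.2 ⟨by linarith, by linarith⟩
  have hcomp : IsCompact K := (isCompact_Icc.prod isCompact_Icc).of_isClosed_subset hclosed hsub
  obtain ⟨⟨t, c⟩, ⟨hs1, hs2⟩, hmin⟩ := hcomp.exists_isMinOn (f := Prod.snd)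
    ⟨(0, c₁), by simpa [hK] using hc₁⟩ continuous_snd.continuousOn
  simp only at hs1 hs2
  have hmin' : ∀ t' c' : ℝ, (∀ l ∈ facetLattice N a, ⟪l, x + t' • e⟫ - a l ≤ c') → c ≤ c' := by
    intro t' c' h
    rcases le_total c' c₁ with h' | h'
    · exact hmin (show (t', c') ∈ K from ⟨h, h'⟩)
    · exact hs2.trans h'
  refine ⟨t, c, hs1, hmin', ?_⟩
  by_contra! hno
  have hlt : ∀ l ∈ facetLattice N a, ⟪l, x + t • e⟫ - a l < c := fun l hl =>
    lt_of_le_of_ne (hs1 l hl) (hno l hl)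
  -- Only finitely many values exceed c - 1, so if none equals c, a bound smaller than c exists.
  set S := {l | l ∈ facetLattice N a ∧ c - 1 ≤ ⟪l, x + t • e⟫ - a l} with hS
  rcases S.eq_empty_or_nonempty with h | h
  · have := hmin' t (c - 1) fun l hl => by
      by_contra! hlt'
      exact Set.notMem_empty l (h ▸ (⟨hl, hlt'.le⟩ : l ∈ S))
    linarith
  · obtain ⟨m, hm, hmmax⟩ := Set.exists_max_image S (fun l => ⟪l, x + t • e⟫ - a l)
      (finite_lattice_le_inner_sub hP hC _ _) h
    have := hmin' t (⟪m, x + t • e⟫ - a m) fun l hl => by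
      by_cases hlS : l ∈ S
      · exact hmmax l hlS
      · have : ⟪l, x + t • e⟫ - a l < c - 1 := by
          by_contra! hle
          exact hlS ⟨hl, hle⟩
        linarith [hm.2]
    linarith [hlt m hm.1]

/-- The projection of `P(a)` along `e` is the Voronoi polytope of the layer `L ∩ e^⊥`. -/
lemma exists_add_smul_mem_of_layer (hP : IsVoronoiParallelotope N a)
    (hC : ContainsContactVectors N (facetLattice N a) a)
    (he : e ∈ dualVectors (facetNormals N a)) {x : RSpace d}
    (hx : ∀ l ∈ facetLattice N a, ⟪l, e⟫ = 0 → ⟪l, x⟫ ≤ a l) :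
    ∃ t : ℝ, x + t • e ∈ polyP (facetLattice N a) a := by
  by_cases hall : ∀ l ∈ facetLattice N a, ⟪l, e⟫ = 0
  · exact ⟨0, fun l hl => by simpa using hx l hl (hall l hl)⟩
  push Not at hall
  obtain ⟨l₀, hl₀, hl₀e⟩ := hall
  obtain ⟨t, c, hle, hmin, hatt⟩ := exists_minimal_level hP hC x hl₀ hl₀e
  refine ⟨t, fun l hl => ?_⟩
  suffices hc : c ≤ 0 by linarith [hle l hl]
  clear hl l
  by_contra! hc
  set A := {l | l ∈ facetLattice N a ∧ ⟪l, x + t • e⟫ - a l = c} with hA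
  have hAfin : A.Finite := (finite_lattice_le_inner_sub hP hC (x + t • e) c).subset
    fun l hl => ⟨hl.1, hl.2.ge⟩
  -- Take the maximiser closest to the layer e^⊥. If it is off the layer, a neighbour is closer, or
  -- moving along ±e lowers the minimum c.
  obtain ⟨l, ⟨hlL, hlc⟩, hlmin⟩ := Set.exists_min_image A (fun l => |⟪l, e⟫|) hAfin hatt
  have hmax : ∀ m ∈ facetLattice N a,
      ⟪m, x + t • e⟫ - a m ≤ ⟪l, x + t • e⟫ - a l := fun m hm => (hle m hm).trans hlc.ge
  obtain ⟨n, hn⟩ := exists_int_inner_eq he hlL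
  have hn0 : n ≠ 0 := by
    rintro rfl
    rw [Int.cast_zero] at hn
    have := hx l hlL hn
    rw [inner_add_right, real_inner_smul_right, hn] at hlc
    linarith
  rcases lt_or_gt_of_ne hn0 with hneg | hpos
  · have hn1 : (n : ℝ) ≤ -1 := by exact_mod_cast (by omega : n ≤ -1)
    rcases exists_neighbour_or_maximal hP hC he hlL hmax with ⟨p, hp, hpe, hpl⟩ | ⟨ε, hε, h⟩
    · have h := hlmin (l + p) ⟨add_mem hlL hp, hpl.trans hlc⟩
      simp only [inner_add_left, hn, hpe] at h
      rw [abs_of_nonpos (by linarith), abs_of_nonpos (by linarith)] at h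
      linarith
    · have := hmin (t + ε) _ fun m hm => by
        rw [add_smul, ← add_assoc]
        exact h m hm
      rw [hn] at this
      nlinarith
  · have hn1 : (1 : ℝ) ≤ n := by exact_mod_cast (by omega : 1 ≤ n)
    rcases exists_neighbour_or_maximal hP hC (neg_mem_dualVectors he) hlL hmax with
      ⟨p, hp, hpe, hpl⟩ | ⟨ε, hε, h⟩
    · have h := hlmin (l + p) ⟨add_mem hlL hp, hpl.trans hlc⟩
      rw [inner_neg_right] at hpe
      simp only [inner_add_left, hn, neg_eq_iff_eq_neg.1 hpe] at h
      rw [abs_of_nonneg (by linarith), abs_of_nonneg (by linarith)] at h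
      linarith
    · have := hmin (t - ε) _ fun m hm => by
        rw [sub_smul, sub_eq_add_neg (t • e), ← smul_neg, ← add_assoc]
        exact h m hm
      rw [inner_neg_right, hn] at this
      nlinarith

/-- The inequalities of the vectors of `N` orthogonal to `e` already imply those of all lattice
vectors orthogonal to `e`. -/
lemma inner_le_of_layer (hP : IsVoronoiParallelotope N a)
    (hC : ContainsContactVectors N (facetLattice N a) a)
    (he : e ∈ dualVectors (facetNormals N a)) {x : RSpace d}
    (hx : ∀ p ∈ N, ⟪p, e⟫ = 0 → ⟪p, x⟫ ≤ a p) :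
    ∀ l ∈ facetLattice N a, ⟪l, e⟫ = 0 → ⟪l, x⟫ ≤ a l := by
  by_contra! hcon
  set S := {l | l ∈ facetLattice N a ∧ ⟪l, e⟫ = 0 ∧ a l < ⟪l, x⟫} with hS
  have hSfin : S.Finite := (finite_lattice_le_inner_sub hP hC x 0).subset
    fun l hl => ⟨hl.1, by linarith [hl.2.2]⟩
  -- Shrink x until all layer inequalities hold and that of l is tight. Lifting sx to P(a) along e
  -- keeps it tight, so l is a contact vector and lies in `N`, where its inequality was assumed.
  obtain ⟨l, hl, hlmin⟩ := Set.exists_min_image S (fun l => a l / ⟪l, x⟫) hSfin hcon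
  have hpos : ∀ m ∈ S, 0 < ⟪m, x⟫ := fun m hm => (hP.nonneg m).trans_lt hm.2.2
  set s := a l / ⟪l, x⟫ with hs
  have hs0 : 0 ≤ s := div_nonneg (hP.nonneg l) (hpos l hl).le
  have hs1 : s ≤ 1 := (div_le_one (hpos l hl)).2 hl.2.2.le
  obtain ⟨t, ht⟩ := exists_add_smul_mem_of_layer hP hC he (x := s • x) fun m hm hme => by
    rw [real_inner_smul_right]
    by_cases hmS : m ∈ S
    · exact (le_div_iff₀ (hpos m hmS)).1 (hlmin m hmS)
    · have h1 : ⟪m, x⟫ ≤ a m := by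
        by_contra! h
        exact hmS ⟨hm, hme, h⟩
      nlinarith [hP.nonneg m]
  have hl0 : l ≠ 0 := by
    rintro rfl
    simpa using hl.2.2
  have hlN : l ∈ N := mem_of_inner_eq hC ht hl.1 hl0 (by
    rw [inner_add_right, real_inner_smul_right, real_inner_smul_right, hl.2.1, mul_zero, add_zero,
      hs, div_mul_cancel₀ _ (hpos l hl).ne'])
  exact absurd (hx l hlN hl.2.1) (not_le.2 hl.2.2)

lemma facetNormals_subset_normalsAt (he : e ∈ dualVectors (facetNormals N a)) :
    facetNormals N a ⊆ normalsAt N e := fun p hp =>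
  ⟨hp.1, by simpa only [real_inner_comm e p] using he p hp⟩

lemma polyP_subset_add_segment (hP : IsVoronoiParallelotope N a)
    (hC : ContainsContactVectors N (facetLattice N a) a)
    (he : e ∈ dualVectors (facetNormals N a)) {b : ℝ} (hb : 0 ≤ b)
    {M : Set (RSpace d)} (hM : normalsAt N e ⊆ M) :
    polyP M (fun p => a p + formAE b e p) ⊆ polyP N a + b • segmentZ e := by
  intro x hx
  obtain ⟨t, ht⟩ := exists_add_smul_mem_of_layer hP hC he <|
    inner_le_of_layer hP hC he (x := x) fun p hp hpe => by
      simpa [formAE, hpe] using hx p (hM ⟨hp, Or.inl hpe⟩)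
  -- For ⟨e, p⟩ = 1 either s = -b, and the inequality of x suffices, or s ≤ t, and that of x + te
  -- does; ⟨e, p⟩ = -1 is symmetric.
  set s := max (-b) (min b t) with hs
  have hs1 : -b ≤ s := le_max_left _ _
  have hs2 : s ≤ b := max_le (by linarith) (min_le_left _ _)
  have hmem : x + s • e ∈ polyP N a := by
    refine polyP_facetNormals_subset hP hC fun p hp => ?_
    have h1 := ht p (facetNormals_subset_lattice hp)
    have h2 := hx p (hM (facetNormals_subset_normalsAt he hp))
    simp only [formAE] at h2
    rw [inner_add_right, real_inner_smul_right] at h1 ⊢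
    rcases he p hp with h | h | h <;> rw [real_inner_comm] at h <;> rw [h] at h1 h2 ⊢
    · linarith
    · rcases max_choice (-b) (min b t) with h' | h' <;> rw [← hs] at h'
      · linarith
      · linarith [min_le_right b t]
    · have : -b ≤ s ∧ (b ≤ s ∨ t ≤ s) :=
        ⟨hs1, by
          rcases min_choice b t with h' | h' <;> rw [h'] at hs <;> rw [hs]
          · exact Or.inl (le_max_right _ _)
          · exact Or.inr (le_max_right _ _)⟩
      rcases this.2 with h' | h' <;> linarith
  refine ⟨x + s • e, hmem, -(s • e), ?_, by simp⟩
  rcases hb.eq_or_lt with rfl | hb0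
  · have : s = 0 := le_antisymm hs2 (by linarith)
    exact ⟨0, ⟨0, by norm_num, by norm_num, by simp⟩, by simp [this]⟩
  · refine ⟨(-s / b) • e, ⟨-s / b, ?_, ?_, rfl⟩, ?_⟩
    · rw [le_div_iff₀ hb0]; linarith
    · rw [div_le_iff₀ hb0]; linarith
    · simp only [smul_smul, mul_div_cancel₀ _ hb0.ne', neg_smul]

lemma smul_segmentZ_subset_polyP (hN : N ⊆ facetLattice N a)
    (he : e ∈ dualVectors (facetNormals N a)) {b : ℝ} (hb : 0 ≤ b)
    {M : Set (RSpace d)} (hMN : M ⊆ N) :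
    b • segmentZ e ⊆ polyP M (formAE b e) := by
  rintro _ ⟨_, ⟨t, ht1, ht2, rfl⟩, rfl⟩ p hp
  obtain ⟨n, hn⟩ := exists_int_inner_eq he (hN (hMN hp))
  simp only [formAE, real_inner_smul_right, hn]
  have h1 : |(n : ℝ)| ≤ (n : ℝ) ^ 2 := by
    exact_mod_cast (Int.natCast_natAbs n ▸ Int.natAbs_le_self_sq n : |n| ≤ n ^ 2)
  have h2 : t * n ≤ |(n : ℝ)| := by
    calc t * n ≤ |t * n| := le_abs_self _
      _ = |t| * |(n : ℝ)| := abs_mul _ _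
      _ ≤ 1 * |(n : ℝ)| := by gcongr; exact abs_le.2 ⟨ht1, ht2⟩
      _ = _ := one_mul _
  exact mul_le_mul_of_nonneg_left (h2.trans h1) hb

lemma polyP_add_polyP_subset {M : Set (RSpace d)} (hMN : M ⊆ N) (f g : RSpace d → ℝ) :
    polyP N f + polyP M g ⊆ polyP M (fun p => f p + g p) := by
  rintro _ ⟨y, hy, z, hz, rfl⟩ p hp
  rw [inner_add_right]
  exact add_le_add (hy p (hMN hp)) (hz p hp)

end Projection

theorem proposition2 {d : ℕ} (N : Set (RSpace d)) (a : QuadraticForm ℝ (RSpace d))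
    (hP : IsVoronoiParallelotope N a)
    (hC : ContainsContactVectors N (facetLattice N a) a)
    (e : RSpace d) (he : e ∈ dualVectors (facetNormals N a))
    (b : ℝ) (hb : 0 ≤ b)
    (M : Set (RSpace d)) (hM : normalsAt N e ⊆ M) (hMN : M ⊆ N) :
    polyP N a + b • segmentZ e = polyP N a + polyP M (formAE b e) ∧
      polyP N a + polyP M (formAE b e) = polyP M (fun p => a p + formAE b e p) := by
  have h1 : polyP N a + b • segmentZ e ⊆ polyP N a + polyP M (formAE b e) :=
    Set.add_subset_add_left (smul_segmentZ_subset_polyP hP.subset_lattice he hb hMN)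
  have h2 := polyP_add_polyP_subset hMN a (formAE b e)
  have h3 := polyP_subset_add_segment hP hC he hb hM
  exact ⟨h1.antisymm (h2.trans h3), h2.antisymm (h3.trans h1)⟩
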